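/- Let $G=(V,E)$ be a finite or infinite, undirected, simple, connected, weighted graph with symmetric edge weights $w(x,y)>0$ for $(x,y)\in E$ (and $w(x,y)=0$ otherwise) such that $w(x):=\sum_{y}w(x,y)<\infty$ for every $x\in V$. Let $P$ be the transition operator $(Pf)(x)=\sum_y \frac{w(x,y)}{w(x)}f(y)$ on the complex Hilbert space $\ell^2(V,w)$ with inner product $\langle f,g\rangle_w=\sum_{x}w(x)f(x)\overline{g(x)}$, and let $\mathcal Q=I+P$ be the (bounded, self-adjoint) probabilistic signless Laplacian, with resolution of the identity $I_{\mathcal Q}$. For $x\in V$ put $e_x=\mathbf 1_x/\sqrt{w(x)}$, and let $$\mu_x^{\mathcal Q}(\delta)=\bigl\langle I_{\mathcal Q}([0,\delta])e_x,e_x\bigr\rangle_w,\qquad 0\le\delta\le 2,$$ be the vertex spectral measure of $\mathcal Q$ at $x$. Assume that $G$ is non-bipartite, that $w(x,y)\ge 1$ for every edge $(x,y)$, and that $G$ is vertex-transitive, i.e. any two vertices are related by a graph automorphism that preserves the edge weights. Let $w$ be the common value of the vertex weights $w(x)$, and let $N^\#(r)$ be the number of vertices at graph distance at most $r$ from a given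 vertex (it does not depend on the vertex). Then for every $x\in V$ and $c\in(0,1)$: 1. for every $\delta\in\bigl(0,\frac2w\bigr]$, $$\mu_x^{\mathcal Q}(\delta)\le\frac{1}{c^2\,N^\#\Bigl(\frac{\arcsin\sqrt{(1-c)/2}}{\arcsin\sqrt{w\delta/2}}\Bigr)};$$ 2. for every $\delta\in(0,2]$, $$\mu_x^{\mathcal Q}(\delta)\le\frac{1}{c^2\,N^\#\Bigl(\frac{\sqrt{1-c}}{\sqrt{w\delta}}\Bigr)}.$$ -/

import Mathlib

noncomputable section

/-- The one-dimensional complex Hilbert space `ℂ` with inner product `⟨a, b⟩ = c * conj a * b`,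
for a weight `c > 0`. -/
def WFiber (_c : {c : ℝ // 0 < c}) : Type := ℂ

namespace WFiber

variable (c : {c : ℝ // 0 < c})

instance : AddCommGroup (WFiber c) := inferInstanceAs (AddCommGroup ℂ)

instance : Module ℂ (WFiber c) := inferInstanceAs (Module ℂ ℂ)

/-- The identification of the vector space underlying `WFiber c` with `ℂ`. -/
def val : WFiber c ≃ₗ[ℂ] ℂ := LinearEquiv.refl ℂ ℂ

/-- The weighted inner product, conjugate linear in the first variable. -/
@[reducible]
def core : InnerProductSpace.Core ℂ (WFiber c) where
  inner a b := (c.1 : ℂ) * (starRingEnd ℂ (val c a) * val c b)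
  conj_inner_symm a b := by
    simp only [map_mul, Complex.conj_ofReal, Complex.conj_conj]
    ring
  re_inner_nonneg a := by
    have h : (c.1 : ℂ) * (starRingEnd ℂ (val c a) * val c a)
        = ((c.1 * Complex.normSq (val c a) : ℝ) : ℂ) := by
      rw [mul_comm (starRingEnd ℂ (val c a)), Complex.mul_conj]; push_cast; ring
    rw [h]
    simpa using mul_nonneg c.2.le (Complex.normSq_nonneg _)
  add_left a b d := by
    simp only [map_add]
    ring
  smul_left a b r := by
    simp only [map_smul, smul_eq_mul, map_mul]
    ring
  definite a h := by
    have hc : (c.1 : ℂ) ≠ 0 := by exact_mod_cast c.2.ne'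
    rcases mul_eq_zero.1 h with h | h
    · exact absurd h hc
    · rcases mul_eq_zero.1 h with h | h
      · exact (val c).map_eq_zero_iff.1 ((map_eq_zero _).1 h)
      · exact (val c).map_eq_zero_iff.1 h

instance : NormedAddCommGroup (WFiber c) := (core c).toNormedAddCommGroup

instance : InnerProductSpace ℂ (WFiber c) := InnerProductSpace.ofCore (core c).toCore

theorem inner_def (a b : WFiber c) :
    inner ℂ a b = (c.1 : ℂ) * (starRingEnd ℂ (val c a) * val c b) := rfl

theorem norm_sq (a : WFiber c) : ‖a‖ ^ 2 = c.1 * ‖val c a‖ ^ 2 := by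
  rw [norm_sq_eq_re_inner (𝕜 := ℂ) a, inner_def, mul_comm (starRingEnd ℂ (val c a)),
    Complex.mul_conj, ← Complex.ofReal_mul, Complex.normSq_eq_norm_sq]
  exact Complex.ofReal_re _

instance : FiniteDimensional ℂ (WFiber c) := (val c).symm.finiteDimensional

instance : CompleteSpace (WFiber c) := FiniteDimensional.complete ℂ _

end WFiber

/-- A locally finite, undirected, simple weighted graph without isolated vertices: edges carry
positive weights, non-edges have weight `0`, and the weights at each vertex are summable. -/
structure WeightedGraph (V : Type*) where
  graph : SimpleGraph V
  weight : V → V → ℝ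
  weight_comm : ∀ x y, weight x y = weight y x
  weight_pos : ∀ x y, graph.Adj x y → 0 < weight x y
  weight_eq_zero : ∀ x y, ¬ graph.Adj x y → weight x y = 0
  summable_weight : ∀ x, Summable (weight x)
  exists_adj : ∀ x, ∃ y, graph.Adj x y

namespace WeightedGraph

variable {V : Type*} (G : WeightedGraph V)

theorem weight_nonneg (x y : V) : 0 ≤ G.weight x y := by
  by_cases h : G.graph.Adj x y
  · exact (G.weight_pos x y h).le
  · exact (G.weight_eq_zero x y h).ge

/-- The weight `w(x) = ∑_y w(x, y)` of a vertex. -/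
def vertexWeight (x : V) : ℝ := ∑' y, G.weight x y

theorem vertexWeight_pos (x : V) : 0 < G.vertexWeight x := by
  obtain ⟨y, hy⟩ := G.exists_adj x
  exact (G.summable_weight x).tsum_pos (G.weight_nonneg x) y (G.weight_pos x y hy)

/-- The weighted Hilbert space `ℓ²(V, w)` of functions `f : V → ℂ` with
`∑_x w(x) |f(x)|² < ∞`. -/
abbrev L2 : Type _ := lp (fun x : V => WFiber ⟨G.vertexWeight x, G.vertexWeight_pos x⟩) 2

/-- The value at the vertex `x` of an element of `ℓ²(V, w)`. -/
def eval (f : G.L2) (x : V) : ℂ := WFiber.val _ (f x)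

theorem inner_eq_tsum (f g : G.L2) :
    inner ℂ f g
      = ∑' x, (G.vertexWeight x : ℂ) * (starRingEnd ℂ (G.eval f x) * G.eval g x) :=
  lp.inner_eq_tsum f g

theorem norm_sq_fiber (f : G.L2) (x : V) :
    ‖f x‖ ^ 2 = G.vertexWeight x * ‖G.eval f x‖ ^ 2 := WFiber.norm_sq _ _

theorem hasSum_norm_sq (f : G.L2) :
    HasSum (fun x => G.vertexWeight x * ‖G.eval f x‖ ^ 2) (‖f‖ ^ 2) := by
  have h := lp.hasSum_norm (p := 2) (by norm_num) f
  simp only [ENNReal.toReal_ofNat, Real.rpow_ofNat] at h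
  simpa only [norm_sq_fiber] using h

theorem memℓp_of_summable (u : V → ℂ)
    (hu : Summable fun x => G.vertexWeight x * ‖u x‖ ^ 2) :
    Memℓp (fun x : V =>
      (WFiber.val ⟨G.vertexWeight x, G.vertexWeight_pos x⟩).symm (u x)) 2 := by
  apply memℓp_gen
  simp only [ENNReal.toReal_ofNat, Real.rpow_ofNat, WFiber.norm_sq, LinearEquiv.apply_symm_apply]
  exact hu

/-- A function `u` with `∑_x w(x) |u(x)|² < ∞` as an element of `ℓ²(V, w)`. -/
def ofFun (u : V → ℂ) (hu : Summable fun x => G.vertexWeight x * ‖u x‖ ^ 2) : G.L2 :=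
  ⟨fun x => (WFiber.val _).symm (u x), G.memℓp_of_summable u hu⟩

theorem eval_ofFun (u : V → ℂ) (hu : Summable fun x => G.vertexWeight x * ‖u x‖ ^ 2) (x : V) :
    G.eval (G.ofFun u hu) x = u x := (WFiber.val _).apply_symm_apply _

theorem ext_eval {f g : G.L2} (h : ∀ x, G.eval f x = G.eval g x) : f = g := by
  apply lp.ext
  funext x
  exact (WFiber.val _).injective (h x)

theorem eval_add (f g : G.L2) (x : V) : G.eval (f + g) x = G.eval f x + G.eval g x := rfl

theorem eval_smul (a : ℂ) (f : G.L2) (x : V) : G.eval (a • f) x = a * G.eval f x := rfl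

/-- The transition probability `p(x, y) = w(x, y) / w(x)` of the random walk. -/
def transProb (x y : V) : ℝ := G.weight x y / G.vertexWeight x

theorem transProb_nonneg (x y : V) : 0 ≤ G.transProb x y :=
  div_nonneg (G.weight_nonneg x y) (G.vertexWeight_pos x).le

theorem vertexWeight_mul_transProb (x y : V) :
    G.vertexWeight x * G.transProb x y = G.weight x y :=
  mul_div_cancel₀ _ (G.vertexWeight_pos x).ne'

theorem hasSum_transProb (x : V) : HasSum (G.transProb x) 1 := by
  have h := (G.summable_weight x).hasSum.div_const (G.vertexWeight x)
  rwa [show ∑' y, G.weight x y = G.vertexWeight x from rfl,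
    div_self (G.vertexWeight_pos x).ne'] at h

theorem summable_edge (f : G.L2) :
    Summable fun q : V × V => G.weight q.1 q.2 * ‖G.eval f q.2‖ ^ 2 := by
  rw [← (Equiv.prodComm V V).summable_iff]
  refine (summable_prod_of_nonneg ?_).2 ⟨?_, ?_⟩
  · intro q
    exact mul_nonneg (G.weight_nonneg _ _) (sq_nonneg _)
  · intro y
    simpa [Function.comp_def, G.weight_comm _ y] using
      (G.summable_weight y).mul_right (‖G.eval f y‖ ^ 2)
  · simpa [Function.comp_def, G.weight_comm, tsum_mul_right, vertexWeight] using
      (G.hasSum_norm_sq f).summable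

theorem tsum_edge (f : G.L2) :
    ∑' q : V × V, G.weight q.1 q.2 * ‖G.eval f q.2‖ ^ 2 = ‖f‖ ^ 2 := by
  rw [← (Equiv.prodComm V V).tsum_eq, Summable.tsum_prod]
  · rw [← (G.hasSum_norm_sq f).tsum_eq]
    refine tsum_congr fun y => ?_
    simp only [Equiv.prodComm_apply, Prod.fst_swap, Prod.snd_swap, tsum_mul_right,
      G.weight_comm _ y, vertexWeight]
  · exact (Equiv.prodComm V V).summable_iff.2 (G.summable_edge f)

theorem summable_transProb_mul_sq (f : G.L2) (x : V) :
    Summable fun y => G.transProb x y * ‖G.eval f y‖ ^ 2 := by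
  have h := (G.summable_edge f).prod_factor x
  simpa [transProb, div_mul_eq_mul_div] using h.div_const (G.vertexWeight x)

theorem summable_transProb_mul_norm (f : G.L2) (x : V) :
    Summable fun y => G.transProb x y * ‖G.eval f y‖ := by
  refine Summable.of_nonneg_of_le
    (fun y => mul_nonneg (G.transProb_nonneg x y) (norm_nonneg _)) (fun y => ?_)
    ((G.hasSum_transProb x).summable.add (G.summable_transProb_mul_sq f x))
  nlinarith [mul_nonneg (G.transProb_nonneg x y) (sq_nonneg (‖G.eval f y‖ - 1)),
    mul_nonneg (G.transProb_nonneg x y) (norm_nonneg (G.eval f y))]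

theorem summable_transProb_mul (f : G.L2) (x : V) :
    Summable fun y => (G.transProb x y : ℂ) * G.eval f y := by
  refine Summable.of_norm ?_
  simpa [abs_of_nonneg (G.transProb_nonneg x _)] using G.summable_transProb_mul_norm f x

/-- The function `(P f)(x) = ∑_y p(x, y) f(y)`. -/
def transFun (f : G.L2) (x : V) : ℂ := ∑' y, (G.transProb x y : ℂ) * G.eval f y

theorem norm_transFun_sq_le (f : G.L2) (x : V) :
    ‖G.transFun f x‖ ^ 2 ≤ ∑' y, G.transProb x y * ‖G.eval f y‖ ^ 2 := by
  set m := ∑' y, G.transProb x y * ‖G.eval f y‖ with hm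
  have h1 : ‖G.transFun f x‖ ≤ m := by
    have hs := G.summable_transProb_mul_norm f x
    have := norm_tsum_le_tsum_norm (f := fun y => (G.transProb x y : ℂ) * G.eval f y)
      (by simpa [abs_of_nonneg (G.transProb_nonneg x _)] using hs)
    simpa [transFun, hm, abs_of_nonneg (G.transProb_nonneg x _)] using this
  have h2 := (((G.summable_transProb_mul_sq f x).hasSum.sub
    ((G.summable_transProb_mul_norm f x).hasSum.mul_left (2 * m))).add
    ((G.hasSum_transProb x).mul_left (m ^ 2)))
  have h3 := h2.nonneg (fun y => by
    have := mul_nonneg (G.transProb_nonneg x y) (sq_nonneg (‖G.eval f y‖ - m))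
    nlinarith)
  rw [← hm] at h3
  have h4 : ‖G.transFun f x‖ ^ 2 ≤ m ^ 2 := by gcongr
  nlinarith

theorem vertexWeight_mul_norm_transFun_sq_le (f : G.L2) (x : V) :
    G.vertexWeight x * ‖G.transFun f x‖ ^ 2
      ≤ ∑' y, G.weight x y * ‖G.eval f y‖ ^ 2 := by
  refine (mul_le_mul_of_nonneg_left (G.norm_transFun_sq_le f x)
    (G.vertexWeight_pos x).le).trans_eq ?_
  rw [← tsum_mul_left]
  simp only [← mul_assoc, vertexWeight_mul_transProb]

theorem summable_transFun (f : G.L2) :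
    Summable fun x => G.vertexWeight x * ‖G.transFun f x‖ ^ 2 :=
  Summable.of_nonneg_of_le
    (fun x => mul_nonneg (G.vertexWeight_pos x).le (sq_nonneg _))
    (G.vertexWeight_mul_norm_transFun_sq_le f) (G.summable_edge f).prod

/-- The transition operator `P` on `ℓ²(V, w)`: `(P f)(x) = ∑_y p(x, y) f(y)`. -/
def transOp : G.L2 →L[ℂ] G.L2 :=
  LinearMap.mkContinuous
    { toFun := fun f => G.ofFun (G.transFun f) (G.summable_transFun f)
      map_add' := fun f g => by
        apply G.ext_eval
        intro x
        rw [eval_add, eval_ofFun, eval_ofFun, eval_ofFun, transFun, transFun, transFun,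
          ← (G.summable_transProb_mul f x).tsum_add (G.summable_transProb_mul g x)]
        exact tsum_congr fun y => by rw [eval_add, mul_add]
      map_smul' := fun a f => by
        apply G.ext_eval
        intro x
        rw [RingHom.id_apply, eval_smul, eval_ofFun, eval_ofFun, transFun, transFun,
          ← tsum_mul_left]
        exact tsum_congr fun y => by rw [eval_smul]; ring }
    1 (fun f => by
      rw [one_mul]
      refine le_of_sq_le_sq ?_ (norm_nonneg _)
      rw [← G.tsum_edge f, (G.summable_edge f).tsum_prod]
      refine hasSum_le (fun x => ?_) (G.hasSum_norm_sq _) (G.summable_edge f).prod.hasSum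
      simp only [LinearMap.coe_mk, AddHom.coe_mk, eval_ofFun]
      exact G.vertexWeight_mul_norm_transFun_sq_le f x)

theorem eval_transOp (f : G.L2) (x : V) :
    G.eval (G.transOp f) x = ∑' y, (G.transProb x y : ℂ) * G.eval f y :=
  G.eval_ofFun _ (G.summable_transFun f) x

/-- The probabilistic signless Laplacian `Q = I + P` on `ℓ²(V, w)`. -/
def signlessLaplacian : G.L2 →L[ℂ] G.L2 := 1 + G.transOp

theorem summable_edge_mul (f g : G.L2) :
    Summable fun q : V × V =>
      (G.weight q.1 q.2 : ℂ) * (starRingEnd ℂ (G.eval f q.2) * G.eval g q.1) := by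
  have h1 := G.summable_edge f
  have h2 : Summable fun q : V × V => G.weight q.1 q.2 * ‖G.eval g q.1‖ ^ 2 := by
    rw [← (Equiv.prodComm V V).summable_iff]
    simpa [Function.comp_def, G.weight_comm] using G.summable_edge g
  refine Summable.of_norm_bounded (h1.add h2) fun q => ?_
  have hw := G.weight_nonneg q.1 q.2
  simp only [norm_mul, Complex.norm_real, RCLike.norm_conj, Real.norm_of_nonneg hw]
  nlinarith [mul_nonneg hw (sq_nonneg (‖G.eval f q.2‖ - ‖G.eval g q.1‖)),
    mul_nonneg hw (sq_nonneg (‖G.eval f q.2‖)), mul_nonneg hw (sq_nonneg (‖G.eval g q.1‖))]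

theorem inner_transOp_left (f g : G.L2) :
    inner ℂ (G.transOp f) g = ∑' q : V × V,
      (G.weight q.1 q.2 : ℂ) * (starRingEnd ℂ (G.eval f q.2) * G.eval g q.1) := by
  rw [inner_eq_tsum, (G.summable_edge_mul f g).tsum_prod]
  refine tsum_congr fun x => ?_
  rw [eval_transOp, Complex.conj_tsum, ← tsum_mul_right, ← tsum_mul_left]
  refine tsum_congr fun y => ?_
  rw [← G.vertexWeight_mul_transProb x y]
  simp only [map_mul, Complex.conj_ofReal]
  push_cast
  ring

theorem inner_transOp_comm (f g : G.L2) :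
    inner ℂ (G.transOp f) g = inner ℂ f (G.transOp g) := by
  rw [← inner_conj_symm f, inner_transOp_left, inner_transOp_left, Complex.conj_tsum,
    ← (Equiv.prodComm V V).tsum_eq]
  refine tsum_congr fun q => ?_
  simp only [Equiv.prodComm_apply, Prod.fst_swap, Prod.snd_swap, map_mul, Complex.conj_ofReal,
    Complex.conj_conj, G.weight_comm q.2 q.1]
  ring

theorem isSelfAdjoint_signlessLaplacian : IsSelfAdjoint G.signlessLaplacian := by
  refine (IsSelfAdjoint.one _).add ?_
  rw [ContinuousLinearMap.isSelfAdjoint_iff_isSymmetric]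
  exact G.inner_transOp_comm

end WeightedGraph

/-- For a bounded self-adjoint operator `T` on a complex Hilbert space, the value `I_T([a, b])` on
the closed interval `[a, b]` of its resolution of the identity: the orthogonal projection onto the
kernel of `d(T)`, where `d(t) = max 0 (max (a - t) (t - b))` is the distance from `t` to `[a, b]`
and `d(T)` is given by the continuous functional calculus. (As in the classical construction of the
spectral family, in which `I_T((-∞, b])` is the projection onto the kernel of the positive part
`(T - b)⁺`.) -/
def resolutionIcc {H : Type*} [NormedAddCommGroup H] [InnerProductSpace ℂ H] [CompleteSpace H]
    (T : H →L[ℂ] H) (a b : ℝ) : H →L[ℂ] H :=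
  (cfc (fun t : ℝ => max 0 (max (a - t) (t - b))) T).ker.starProjection

namespace WeightedGraph

variable {V : Type*} (G : WeightedGraph V)

open Classical in
/-- The unit vector `e_x = 1_x / √w(x)` of `ℓ²(V, w)`. -/
def unitVec (x : V) : G.L2 :=
  lp.single 2 x ((WFiber.val _).symm ((1 / √(G.vertexWeight x) : ℝ) : ℂ))

open Classical in
theorem eval_unitVec (x y : V) :
    G.eval (G.unitVec x) y = if y = x then ((1 / √(G.vertexWeight x) : ℝ) : ℂ) else 0 := by
  by_cases h : y = x
  · subst h
    simp [eval, unitVec]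
  · simp [eval, unitVec, h]

/-- The vertex spectral measure `μ_x^Q(δ) = ⟨I_Q([0, δ]) e_x, e_x⟩_w` of the probabilistic signless
Laplacian `Q = I + P`. -/
def vertexSpectralMeasure (x : V) (δ : ℝ) : ℝ :=
  (inner ℂ (resolutionIcc G.signlessLaplacian 0 δ (G.unitVec x)) (G.unitVec x)).re

/-- The number of vertices at graph distance at most `r` from `x`. -/
def ballCard (x : V) (r : ℝ) : ℕ := {v : V | (G.graph.dist v x : ℝ) ≤ r}.ncard

/-- Any two vertices are related by a graph automorphism that preserves the edge weights. -/
def IsVertexTransitive : Prop :=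
  ∀ x y : V, ∃ φ : G.graph ≃g G.graph,
    (∀ u v, G.weight (φ u) (φ v) = G.weight u v) ∧ φ x = y

end WeightedGraph

end

/-! Write `f x` for the projection of `e_x` to the range of `I_Q([0, δ])`, and μ for its squared
norm, which transitivity makes independent of x. The Rayleigh quotient of `Q` on this range is at
most δ, and ⟨f x, Q (f x)⟩ is the average over the neighbours z of x of μ + Re⟨f z, f x⟩. These
terms are nonnegative by Cauchy-Schwarz, so each one is controlled separately: since p(x, y) ≥ 1/w,
every edge satisfies μ + Re⟨f y, f x⟩ ≤ wδμ, and f y is close to -f x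
(`IsVertexTransitive.inner_spectralEmbedding_le`).

Along a walk of length n the errors add up, so f x is close to (-1)^n f z. Measuring closeness by
angles gives the first bound, and by chords the second: on the stated ball |⟨f z, f x⟩| ≥ cμ. By
Parseval the squares of these correlations sum to μ, hence N c²μ² ≤ μ
(`vertexSpectralMeasure_le_of_ball`). -/

/-! ### Spectral projections: invariance and the Rayleigh bound -/

section SpectralProjection

variable {H : Type*} [NormedAddCommGroup H] [InnerProductSpace ℂ H] [CompleteSpace H]

theorem inner_resolutionIcc_left (T : H →L[ℂ] H) (a b : ℝ) (u v : H) :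
    inner ℂ (resolutionIcc T a b u) v = inner ℂ u (resolutionIcc T a b v) :=
  Submodule.inner_starProjection_left_eq_right _ u v

theorem resolutionIcc_resolutionIcc (T : H →L[ℂ] H) (a b : ℝ) (v : H) :
    resolutionIcc T a b (resolutionIcc T a b v) = resolutionIcc T a b v :=
  Submodule.starProjection_eq_self_iff.2 (Submodule.starProjection_apply_mem _ v)

/-- An operator that commutes with `T` leaves the range of `I_T([a, b])` invariant. -/
theorem resolutionIcc_apply_of_commute {T S : H →L[ℂ] H} (h : Commute T S) (a b : ℝ) (v : H) :
    resolutionIcc T a b (S (resolutionIcc T a b v)) = S (resolutionIcc T a b v) := by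
  refine Submodule.starProjection_eq_self_iff.2 ?_
  have hc := h.cfc_real fun t : ℝ => max 0 (max (a - t) (t - b))
  have hk : cfc (fun t : ℝ => max 0 (max (a - t) (t - b))) T (resolutionIcc T a b v) = 0 :=
    Submodule.starProjection_apply_mem
      (cfc (fun t : ℝ => max 0 (max (a - t) (t - b))) T).ker v
  have := congrArg (fun A : H →L[ℂ] H => A (resolutionIcc T a b v)) hc.eq
  simpa [hk] using this

/-- With d the distance to [a, b], t ≤ b + d(t) for all t, so T ≤ b + d(T) by the functional
calculus, and d(T) vanishes on the range of the projection. -/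
theorem re_inner_apply_resolutionIcc_le {T : H →L[ℂ] H} (hT : IsSelfAdjoint T) (a b : ℝ) (v : H) :
    (inner ℂ (resolutionIcc T a b v) (T (resolutionIcc T a b v))).re
      ≤ b * ‖resolutionIcc T a b v‖ ^ 2 := by
  set d : ℝ → ℝ := fun t => max 0 (max (a - t) (t - b)) with hd
  have hdc : Continuous d := by fun_prop
  set k := resolutionIcc T a b v with hk
  have hk0 : cfc d T k = 0 := Submodule.starProjection_apply_mem (cfc d T).ker v
  have hpos : 0 ≤ cfc (fun t => b + d t - t) T := cfc_nonneg fun t _ => by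
    have : t - b ≤ d t := (le_max_right _ _).trans (le_max_right _ _)
    linarith
  rw [cfc_sub (fun t => b + d t) (fun t => t) T (by fun_prop) (by fun_prop),
    cfc_const_add b d T (by fun_prop), cfc_id' ℝ T, ContinuousLinearMap.nonneg_iff_isPositive]
    at hpos
  have h := hpos.re_inner_nonneg_right k
  have hb : (algebraMap ℝ (H →L[ℂ] H) b) k = (b : ℂ) • k := by
    rw [Algebra.algebraMap_eq_smul_one]
    simp
  simp only [sub_apply, add_apply, hk0, hb, add_zero,
    inner_sub_right, inner_smul_right, map_sub, RCLike.re_to_complex, Complex.re_ofReal_mul] at h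
  rw [norm_sq_eq_re_inner (𝕜 := ℂ) k, RCLike.re_to_complex]
  linarith

/-- An isometry that commutes with `T` does not decrease the spectral mass of a vector. -/
theorem norm_resolutionIcc_le_of_commute {T : H →L[ℂ] H} (U : H →ₗᵢ[ℂ] H)
    (h : Commute T U.toContinuousLinearMap) (a b : ℝ) (v : H) :
    ‖resolutionIcc T a b v‖ ≤ ‖resolutionIcc T a b (U v)‖ := by
  have hU := resolutionIcc_apply_of_commute h a b v
  simp only [LinearIsometry.coe_toContinuousLinearMap] at hU
  set k := resolutionIcc T a b v with hk
  -- `U k` lies in the range of the projection, which can therefore be dropped; `U` then cancels.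
  -- Cauchy-Schwarz concludes.
  have h1 : inner ℂ (resolutionIcc T a b (U v)) (U k) = ((‖k‖ ^ 2 : ℝ) : ℂ) := by
    rw [inner_resolutionIcc_left, hU, U.inner_map_map, hk, ← resolutionIcc_resolutionIcc,
      ← inner_resolutionIcc_left, resolutionIcc_resolutionIcc, inner_self_eq_norm_sq_to_K]
    push_cast
    rfl
  have h2 := norm_inner_le_norm (𝕜 := ℂ) (resolutionIcc T a b (U v)) (U k)
  rw [h1, Complex.norm_real, Real.norm_of_nonneg (sq_nonneg _), U.norm_map, sq] at h2
  rcases (norm_nonneg k).eq_or_lt with h0 | h0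
  · rw [← h0]; exact norm_nonneg _
  · exact le_of_mul_le_mul_right h2 h0

end SpectralProjection

/-! ### Action of weight-preserving automorphisms -/

namespace WeightedGraph

variable {V : Type*} (G : WeightedGraph V)

theorem inner_unitVec_left (x : V) (f : G.L2) :
    inner ℂ (G.unitVec x) f = (√(G.vertexWeight x) : ℂ) * G.eval f x := by
  classical
  have hw := G.vertexWeight_pos x
  have h : inner ℂ (G.unitVec x) f
      = inner ℂ ((WFiber.val ⟨G.vertexWeight x, hw⟩).symm
          ((1 / √(G.vertexWeight x) : ℝ) : ℂ)) (f x) := by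
    rw [unitVec]
    convert lp.inner_single_left (𝕜 := ℂ) x _ f
  rw [h, WFiber.inner_def, LinearEquiv.apply_symm_apply, Complex.conj_ofReal, ← mul_assoc,
    ← Complex.ofReal_mul, mul_one_div, Real.div_sqrt]
  rfl

theorem vertexSpectralMeasure_eq_norm_sq (x : V) (δ : ℝ) :
    G.vertexSpectralMeasure x δ
      = ‖resolutionIcc G.signlessLaplacian 0 δ (G.unitVec x)‖ ^ 2 := by
  rw [vertexSpectralMeasure, ← resolutionIcc_resolutionIcc, inner_resolutionIcc_left,
    resolutionIcc_resolutionIcc, norm_sq_eq_re_inner (𝕜 := ℂ), RCLike.re_to_complex]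

theorem eval_signlessLaplacian (f : G.L2) (x : V) :
    G.eval (G.signlessLaplacian f) x
      = G.eval f x + ∑' y, (G.transProb x y : ℂ) * G.eval f y := by
  rw [← eval_transOp]
  rfl

theorem hasSum_norm_sq_perm (φ : V ≃ V) (hφ : ∀ x, G.vertexWeight (φ x) = G.vertexWeight x)
    (f : G.L2) :
    HasSum (fun x => G.vertexWeight x * ‖G.eval f (φ.symm x)‖ ^ 2) (‖f‖ ^ 2) := by
  rw [← φ.hasSum_iff]
  simpa [Function.comp_def, hφ] using G.hasSum_norm_sq f

/-- The action on `ℓ²(V, w)` of a permutation of the vertices that preserves the weights. -/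
noncomputable def permIsometry (φ : V ≃ V) (hφ : ∀ x, G.vertexWeight (φ x) = G.vertexWeight x) :
    G.L2 →ₗᵢ[ℂ] G.L2 where
  toFun f := G.ofFun (fun x => G.eval f (φ.symm x)) (G.hasSum_norm_sq_perm φ hφ f).summable
  map_add' f g := G.ext_eval fun x => by simp only [eval_add, eval_ofFun]
  map_smul' a f := G.ext_eval fun x => by simp only [RingHom.id_apply, eval_smul, eval_ofFun]
  norm_map' f := by
    have h := G.hasSum_norm_sq (G.ofFun _ (G.hasSum_norm_sq_perm φ hφ f).summable)
    simp only [eval_ofFun] at h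
    exact (sq_eq_sq₀ (norm_nonneg _) (norm_nonneg _)).1 (h.unique (G.hasSum_norm_sq_perm φ hφ f))

theorem eval_permIsometry (φ : V ≃ V) (hφ : ∀ x, G.vertexWeight (φ x) = G.vertexWeight x)
    (f : G.L2) (x : V) : G.eval (G.permIsometry φ hφ f) x = G.eval f (φ.symm x) :=
  G.eval_ofFun _ (G.hasSum_norm_sq_perm φ hφ f).summable x

theorem permIsometry_unitVec (φ : V ≃ V) (hφ : ∀ x, G.vertexWeight (φ x) = G.vertexWeight x)
    (x : V) : G.permIsometry φ hφ (G.unitVec x) = G.unitVec (φ x) := by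
  classical
  refine G.ext_eval fun y => ?_
  simp only [eval_permIsometry, eval_unitVec, hφ, Equiv.symm_apply_eq]

theorem vertexWeight_perm (φ : V ≃ V) (hφ : ∀ x y, G.weight (φ x) (φ y) = G.weight x y) (x : V) :
    G.vertexWeight (φ x) = G.vertexWeight x := by
  rw [vertexWeight, ← φ.tsum_eq]
  simp only [hφ, vertexWeight]

theorem commute_permIsometry (φ : V ≃ V) (hφ : ∀ x y, G.weight (φ x) (φ y) = G.weight x y) :
    Commute G.signlessLaplacian
      (G.permIsometry φ (G.vertexWeight_perm φ hφ)).toContinuousLinearMap := by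
  refine ContinuousLinearMap.ext fun f => G.ext_eval fun x => ?_
  obtain ⟨x, rfl⟩ := φ.surjective x
  simp only [mul_apply_eq_comp, LinearIsometry.coe_toContinuousLinearMap,
    eval_signlessLaplacian, eval_permIsometry, Equiv.symm_apply_apply]
  rw [← φ.tsum_eq]
  simp only [Equiv.symm_apply_apply, transProb, hφ, G.vertexWeight_perm φ hφ]

variable {G}

theorem IsVertexTransitive.vertexWeight_eq (h : G.IsVertexTransitive) (x y : V) :
    G.vertexWeight x = G.vertexWeight y := by
  obtain ⟨φ, hφ, rfl⟩ := h x y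
  exact (G.vertexWeight_perm φ.toEquiv hφ x).symm

/-- As x and y are arbitrary, the one-sided bound already yields equality. -/
theorem IsVertexTransitive.norm_resolutionIcc_unitVec_le (h : G.IsVertexTransitive) (a b : ℝ)
    (x y : V) : ‖resolutionIcc G.signlessLaplacian a b (G.unitVec x)‖
      ≤ ‖resolutionIcc G.signlessLaplacian a b (G.unitVec y)‖ := by
  obtain ⟨φ, hφ, rfl⟩ := h x y
  have h1 := norm_resolutionIcc_le_of_commute _ (G.commute_permIsometry φ.toEquiv hφ) a b
    (G.unitVec x)
  rwa [permIsometry_unitVec] at h1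

theorem IsVertexTransitive.vertexSpectralMeasure_eq (h : G.IsVertexTransitive) (δ : ℝ) (x y : V) :
    G.vertexSpectralMeasure x δ = G.vertexSpectralMeasure y δ := by
  rw [vertexSpectralMeasure_eq_norm_sq, vertexSpectralMeasure_eq_norm_sq,
    (h.norm_resolutionIcc_unitVec_le 0 δ x y).antisymm (h.norm_resolutionIcc_unitVec_le 0 δ y x)]

/-! ### The spectral embedding: Parseval, edges and balls -/

variable (G)

/-- The spectral embedding `x ↦ I_Q([0, δ]) e_x`. -/
noncomputable def spectralEmbedding (δ : ℝ) (x : V) : G.L2 :=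
  resolutionIcc G.signlessLaplacian 0 δ (G.unitVec x)

theorem norm_sq_spectralEmbedding (δ : ℝ) (x : V) :
    ‖G.spectralEmbedding δ x‖ ^ 2 = G.vertexSpectralMeasure x δ :=
  (G.vertexSpectralMeasure_eq_norm_sq x δ).symm

theorem inner_spectralEmbedding (δ : ℝ) (x y : V) :
    inner ℂ (G.spectralEmbedding δ y) (G.spectralEmbedding δ x)
      = (√(G.vertexWeight y) : ℂ) * G.eval (G.spectralEmbedding δ x) y := by
  rw [← inner_unitVec_left, spectralEmbedding, spectralEmbedding, inner_resolutionIcc_left,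
    resolutionIcc_resolutionIcc]

/-- Parseval's identity for the spectral embedding. -/
theorem hasSum_norm_inner_spectralEmbedding (δ : ℝ) (x : V) :
    HasSum (fun y => ‖inner ℂ (G.spectralEmbedding δ y) (G.spectralEmbedding δ x)‖ ^ 2)
      (G.vertexSpectralMeasure x δ) := by
  rw [← norm_sq_spectralEmbedding]
  convert G.hasSum_norm_sq (G.spectralEmbedding δ x) using 2 with y
  rw [inner_spectralEmbedding, norm_mul, mul_pow, Complex.norm_real,
    Real.norm_of_nonneg (Real.sqrt_nonneg _), Real.sq_sqrt (G.vertexWeight_pos y).le]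

variable {G}

/-- Adjacent vertices are nearly antipodal in the spectral embedding. -/
theorem IsVertexTransitive.inner_spectralEmbedding_le (h : G.IsVertexTransitive)
    (hweight : ∀ x y, G.graph.Adj x y → 1 ≤ G.weight x y) {δ : ℝ} {x y : V}
    (hxy : G.graph.Adj x y) :
    G.vertexSpectralMeasure x δ
        + (inner ℂ (G.spectralEmbedding δ y) (G.spectralEmbedding δ x)).re
      ≤ G.vertexWeight x * δ * G.vertexSpectralMeasure x δ := by
  set f := G.spectralEmbedding δ
  set μ := G.vertexSpectralMeasure x δ with hμ
  have hw := G.vertexWeight_pos x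
  have hf (z : V) : ‖f z‖ ^ 2 = μ := by
    rw [hμ, h.vertexSpectralMeasure_eq δ x z]
    exact G.norm_sq_spectralEmbedding δ z
  -- This is ‖f z + f x‖² / 2, because both vectors have squared norm μ.
  have hnn (z : V) : 0 ≤ μ + (inner ℂ (f z) (f x)).re := by
    have h1 := norm_add_sq (𝕜 := ℂ) (f z) (f x)
    rw [hf, hf, RCLike.re_to_complex] at h1
    nlinarith [sq_nonneg ‖f z + f x‖]
  -- `Q` preserves the range of the projection, so f x may be replaced by `e_x` on the left. Equal
  -- vertex weights turn √w(x) times the value of f x at z into ⟨f z, f x⟩.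
  have hQ : inner ℂ (f x) (G.signlessLaplacian (f x))
      = inner ℂ (f x) (f x) + ∑' z, (G.transProb x z : ℂ) * inner ℂ (f z) (f x) := by
    have h1 : inner ℂ (f x) (G.signlessLaplacian (f x))
        = inner ℂ (G.unitVec x) (G.signlessLaplacian (f x)) := by
      have := resolutionIcc_apply_of_commute (Commute.refl G.signlessLaplacian) 0 δ (G.unitVec x)
      rw [show f x = resolutionIcc G.signlessLaplacian 0 δ (G.unitVec x) from rfl,
        inner_resolutionIcc_left, this]
    rw [h1, inner_unitVec_left, eval_signlessLaplacian, mul_add, ← tsum_mul_left,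
      inner_spectralEmbedding]
    congr 1
    refine tsum_congr fun z => ?_
    rw [inner_spectralEmbedding, h.vertexWeight_eq z x]
    ring
  have hs : Summable fun z => (G.transProb x z : ℂ) * inner ℂ (f z) (f x) := by
    refine ((G.summable_transProb_mul (f x) x).mul_left (√(G.vertexWeight x) : ℂ)).congr fun z => ?_
    rw [inner_spectralEmbedding, h.vertexWeight_eq z x]
    ring
  have hre : HasSum (fun z => G.transProb x z * (inner ℂ (f z) (f x)).re)
      ((∑' z, (G.transProb x z : ℂ) * inner ℂ (f z) (f x)).re) := by
    simpa only [Complex.re_ofReal_mul] using Complex.hasSum_re hs.hasSum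
  have htot := ((G.hasSum_transProb x).mul_right μ).add hre
  have hle : (inner ℂ (f x) (G.signlessLaplacian (f x))).re ≤ δ * μ := by
    rw [← hf x]
    exact re_inner_apply_resolutionIcc_le G.isSelfAdjoint_signlessLaplacian 0 δ (G.unitVec x)
  rw [hQ, Complex.add_re] at hle
  have hxx : (inner ℂ (f x) (f x)).re = μ := by
    rw [← hf x, norm_sq_eq_re_inner (𝕜 := ℂ), RCLike.re_to_complex]
  -- By nonnegativity, the single term at y is at most the whole sum.
  have hterm := le_hasSum htot y fun z _ => by
    rw [← mul_add]
    exact mul_nonneg (G.transProb_nonneg x z) (hnn z)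
  rw [← mul_add] at hterm
  have hP : G.transProb x y * (μ + (inner ℂ (f y) (f x)).re) ≤ δ * μ := by linarith
  calc μ + (inner ℂ (f y) (f x)).re
      ≤ G.weight x y * (μ + (inner ℂ (f y) (f x)).re) :=
        le_mul_of_one_le_left (hnn y) (hweight x y hxy)
    _ = G.vertexWeight x * (G.transProb x y * (μ + (inner ℂ (f y) (f x)).re)) := by
        rw [← mul_assoc, vertexWeight_mul_transProb]
    _ ≤ G.vertexWeight x * (δ * μ) := by gcongr
    _ = _ := by ring

/-- If the spectral embedding of `x` has a correlation at least `c` with that of each vertex of the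
ball of radius `r` about `x`, then the spectral measure at `x` is at most `1 / (c² N(r))`. -/
theorem vertexSpectralMeasure_le_of_ball {δ c r : ℝ} (x : V) (hc : 0 < c) (hr : 0 ≤ r)
    (hball : 0 < G.vertexSpectralMeasure x δ → ∀ z, (G.graph.dist z x : ℝ) ≤ r →
      c * G.vertexSpectralMeasure x δ
        ≤ ‖inner ℂ (G.spectralEmbedding δ z) (G.spectralEmbedding δ x)‖) :
    G.vertexSpectralMeasure x δ ≤ 1 / (c ^ 2 * G.ballCard x r) := by
  set μ := G.vertexSpectralMeasure x δ with hμ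
  have hμ0 : 0 ≤ μ := by
    rw [hμ, vertexSpectralMeasure_eq_norm_sq]
    positivity
  -- For μ = 0 only nonnegativity of the right side is needed, which holds whatever the value of
  -- `ballCard`.
  rcases hμ0.eq_or_lt with h0 | h0
  · rw [← h0]
    positivity
  have hsum := G.hasSum_norm_inner_spectralEmbedding δ x
  rw [← hμ] at hsum
  set B : Set V := {v : V | (G.graph.dist v x : ℝ) ≤ r} with hB
  have hB' (z) (hz : z ∈ B) :
      (c * μ) ^ 2 ≤ ‖inner ℂ (G.spectralEmbedding δ z) (G.spectralEmbedding δ x)‖ ^ 2 := by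
    have := hball h0 z hz
    gcongr
  -- Finiteness of the ball comes from Parseval: only finitely many terms of a convergent sum are at
  -- least (cμ)² > 0. It ensures that `ncard` is the true cardinality.
  have hfin : B.Finite := by
    have h1 := hsum.summable.tendsto_cofinite_zero.eventually_lt_const
      (show 0 < (c * μ) ^ 2 by positivity)
    rw [Filter.eventually_cofinite] at h1
    exact h1.subset fun z hz => (hB' z hz).not_gt
  have hcard : G.ballCard x r = hfin.toFinset.card := Set.ncard_eq_toFinset_card B hfin
  have hpos : 0 < hfin.toFinset.card :=
    Finset.card_pos.2 ⟨x, hfin.mem_toFinset.2 (by simpa [hB] using hr)⟩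
  have hle : hfin.toFinset.card * (c * μ) ^ 2 ≤ μ := by
    rw [← nsmul_eq_mul]
    exact (Finset.card_nsmul_le_sum _ _ _ fun z hz => hB' z (hfin.mem_toFinset.1 hz)).trans
      (sum_le_hasSum _ (fun z _ => sq_nonneg _) hsum)
  have hN : (0 : ℝ) < hfin.toFinset.card := by exact_mod_cast hpos
  rw [hcard, le_div_iff₀ (by positivity)]
  refine le_of_mul_le_mul_right ?_ h0
  linarith

end WeightedGraph

/-! ### Chaining near-antipodality along walks -/

section WalkEstimates

variable {V E : Type*} [NormedAddCommGroup E] [InnerProductSpace ℝ E] {Γ : SimpleGraph V}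
  {f : V → E} {μ η c : ℝ}

open InnerProductGeometry

/-- Chaining along a walk an estimate of `d (f x) (-f y)` for adjacent `x`, `y`, where `d` satisfies
the triangle inequality and is invariant under `v ↦ -v`. -/
theorem SimpleGraph.Walk.le_length_mul {d : E → E → ℝ} (htri : ∀ u v w, d u w ≤ d u v + d v w)
    (hneg : ∀ u v, d (-u) (-v) = d u v) (hself : ∀ x, d (f x) (f x) = 0) {A : ℝ}
    (hA : ∀ x y, Γ.Adj x y → d (f x) (-f y) ≤ A) {x z : V} (p : Γ.Walk x z) :
    d (f x) ((-1 : ℝ) ^ p.length • f z) ≤ p.length * A := by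
  induction p with
  | nil => simp [hself]
  | @cons x y z h p ih =>
    have h1 := htri (f x) (-f y) ((-1 : ℝ) ^ (p.length + 1) • f z)
    -- Negating both arguments of the second distance reduces it to the one in the induction
    -- hypothesis.
    rw [pow_succ, mul_neg_one, neg_smul, hneg] at h1
    rw [SimpleGraph.Walk.length_cons, pow_succ, mul_neg_one, neg_smul, Nat.cast_add_one, add_mul,
      one_mul]
    linarith [hA x y h]

theorem neg_one_pow_mul_le_abs (n : ℕ) (a : ℝ) : (-1) ^ n * a ≤ |a| := by
  refine (le_abs_self _).trans_eq ?_
  rw [abs_mul, abs_neg_one_pow, one_mul]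

/-- Chaining with d the angle. The edge bound says that the cosine of the angle from f x to -f y is
at least 1 - η, and the target is a cosine at least c. Both constants arise from cos(2 arcsin √a) =
1 - 2a, with a = η/2 and a = (1 - c)/2; η ≤ 2 keeps √(η/2) in the domain of arcsin. -/
theorem SimpleGraph.Walk.le_abs_inner_of_arcsin (hμ : 0 < μ) (hf : ∀ x, ‖f x‖ ^ 2 = μ)
    (hadj : ∀ x y, Γ.Adj x y → μ + inner ℝ (f x) (f y) ≤ η * μ) (hη : 0 ≤ η) (hη2 : η ≤ 2)
    (hc : 0 < c) (hc1 : c < 1) {x z : V} (p : Γ.Walk x z)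
    (hp : p.length * Real.arcsin √(η / 2) ≤ Real.arcsin √((1 - c) / 2)) :
    c * μ ≤ |inner ℝ (f x) (f z)| := by
  have hnorm (x y : V) : ‖f x‖ * ‖f y‖ = μ := by
    rw [← hf x, sq, (sq_eq_sq₀ (norm_nonneg (f y)) (norm_nonneg (f x))).1 (by rw [hf, hf])]
  have hne (x : V) : f x ≠ 0 := fun h => by
    have := hf x
    simp [h] at this
    exact hμ.ne this
  have hcos {a : ℝ} (h0 : 0 ≤ a) (h1 : a ≤ 1) : Real.cos (2 * Real.arcsin √a) = 1 - 2 * a := by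
    rw [Real.cos_two_mul, Real.cos_sq', Real.sin_arcsin, Real.sq_sqrt h0]
    · ring
    · linarith [Real.sqrt_nonneg a]
    · exact Real.sqrt_le_one.2 h1
  have hedge (x y : V) (h : Γ.Adj x y) : angle (f x) (-f y) ≤ 2 * Real.arcsin √(η / 2) := by
    have h2 : 2 * Real.arcsin √(η / 2) ≤ Real.pi := by
      linarith [Real.arcsin_le_pi_div_two √(η / 2)]
    have h0 : 0 ≤ 2 * Real.arcsin √(η / 2) :=
      mul_nonneg zero_le_two (Real.arcsin_nonneg.2 (Real.sqrt_nonneg _))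
    rw [← Real.arccos_cos h0 h2, hcos (by linarith) (by linarith), angle]
    refine Real.arccos_le_arccos ?_
    rw [norm_neg, hnorm, inner_neg_right, le_div_iff₀ hμ]
    linarith [hadj x y h]
  have hangle := p.le_length_mul angle_le_angle_add_angle angle_neg_neg
    (fun x => angle_self (hne x)) hedge
  have hle : angle (f x) ((-1 : ℝ) ^ p.length • f z) ≤ 2 * Real.arcsin √((1 - c) / 2) := by
    linarith
  have hcosle := Real.cos_le_cos_of_nonneg_of_le_pi (angle_nonneg _ _)
    (by linarith [Real.arcsin_le_pi_div_two √((1 - c) / 2)]) hle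
  rw [hcos (by linarith) (by linarith), cos_angle, norm_smul, norm_pow, norm_neg, norm_one, one_pow,
    one_mul, hnorm, le_div_iff₀ hμ, inner_smul_right] at hcosle
  linarith [neg_one_pow_mul_le_abs p.length (inner ℝ (f x) (f z))]

/-- Chaining with d the norm distance. An edge gives ‖f x + f y‖² ≤ 2ημ, and ‖f x ∓ f z‖² ≤ 2(1 -
c)μ is the same as ±⟨f x, f z⟩ ≥ cμ. Chords need no upper bound on η. -/
theorem SimpleGraph.Walk.le_abs_inner_of_sqrt (hf : ∀ x, ‖f x‖ ^ 2 = μ)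
    (hadj : ∀ x y, Γ.Adj x y → μ + inner ℝ (f x) (f y) ≤ η * μ) (hη : 0 ≤ η)
    (hc1 : c < 1) {x z : V} (p : Γ.Walk x z) (hp : p.length * √η ≤ √(1 - c)) :
    c * μ ≤ |inner ℝ (f x) (f z)| := by
  have hμ : 0 ≤ μ := hf x ▸ sq_nonneg _
  have hedge (x y : V) (h : Γ.Adj x y) : Dist.dist (f x) (-f y) ≤ √η * √(2 * μ) := by
    rw [← Real.sqrt_mul hη]
    refine Real.le_sqrt_of_sq_le ?_
    rw [dist_eq_norm, sub_neg_eq_add, norm_add_sq_real, hf, hf]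
    linarith [hadj x y h]
  have hdist := p.le_length_mul dist_triangle dist_neg_neg (fun x => _root_.dist_self _) hedge
  have hle : ‖f x - (-1 : ℝ) ^ p.length • f z‖ ≤ √(1 - c) * √(2 * μ) := by
    rw [← dist_eq_norm]
    refine hdist.trans ?_
    rw [← mul_assoc]
    gcongr
  have hsq := pow_le_pow_left₀ (norm_nonneg _) hle 2
  rw [mul_pow, Real.sq_sqrt (by linarith), Real.sq_sqrt (by linarith), norm_sub_sq_real, norm_smul,
    norm_pow, norm_neg, norm_one, one_pow, one_mul, hf, hf, inner_smul_right] at hsq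
  linarith [neg_one_pow_mul_le_abs p.length (inner ℝ (f x) (f z))]

end WalkEstimates

/-! ### The main theorem -/

theorem mainTheorem7 {V : Type*} (G : WeightedGraph V)
    (hconn : G.graph.Connected)
    (hbip : ¬ G.graph.IsBipartite)
    (htrans : G.IsVertexTransitive)
    (hweight : ∀ x y, G.graph.Adj x y → 1 ≤ G.weight x y)
    (x : V) (c : ℝ) (hc : c ∈ Set.Ioo (0 : ℝ) 1) :
    (∀ δ ∈ Set.Ioc (0 : ℝ) (2 / G.vertexWeight x),
      G.vertexSpectralMeasure x δ ≤
        1 / (c ^ 2 * G.ballCard x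
          (Real.arcsin √((1 - c) / 2) / Real.arcsin √(G.vertexWeight x * δ / 2)))) ∧
    (∀ δ ∈ Set.Ioc (0 : ℝ) 2,
      G.vertexSpectralMeasure x δ ≤
        1 / (c ^ 2 * G.ballCard x (√(1 - c) / √(G.vertexWeight x * δ)))) := by
  -- Angles live in a real inner product space, so Re⟨·,·⟩ is used; passing back to the complex
  -- correlation costs only |Re a| ≤ |a|.
  let _ : InnerProductSpace ℝ G.L2 := InnerProductSpace.rclikeToReal ℂ G.L2
  have hre (u v : G.L2) : inner ℝ u v = (inner ℂ u v).re := rfl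
  have hw := G.vertexWeight_pos x
  have hf (δ : ℝ) (z : V) : ‖G.spectralEmbedding δ z‖ ^ 2 = G.vertexSpectralMeasure x δ := by
    rw [htrans.vertexSpectralMeasure_eq δ x z, G.norm_sq_spectralEmbedding]
  have hadj (δ : ℝ) (y z : V) (h : G.graph.Adj y z) : G.vertexSpectralMeasure x δ
      + inner ℝ (G.spectralEmbedding δ y) (G.spectralEmbedding δ z)
        ≤ G.vertexWeight x * δ * G.vertexSpectralMeasure x δ := by
    rw [htrans.vertexSpectralMeasure_eq δ x z, htrans.vertexWeight_eq x z, hre]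
    exact htrans.inner_spectralEmbedding_le hweight h.symm
  refine ⟨fun δ hδ => ?_, fun δ hδ => ?_⟩
  · have hη : 0 < G.vertexWeight x * δ := mul_pos hw hδ.1
    have hη2 : G.vertexWeight x * δ ≤ 2 := by
      rw [mul_comm, ← le_div_iff₀ hw]
      exact hδ.2
    have hA : 0 < Real.arcsin √(G.vertexWeight x * δ / 2) :=
      Real.arcsin_pos.2 (Real.sqrt_pos.2 (by linarith))
    refine WeightedGraph.vertexSpectralMeasure_le_of_ball x hc.1
      (div_nonneg (Real.arcsin_nonneg.2 (Real.sqrt_nonneg _)) hA.le) fun hμ z hz => ?_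
    -- For a geodesic walk, the choice of radius is exactly the length condition of the chaining
    -- lemma.
    obtain ⟨p, hp⟩ := hconn.exists_walk_length_eq_dist z x
    rw [← hp, le_div_iff₀ hA] at hz
    exact (p.le_abs_inner_of_arcsin hμ (hf δ) (hadj δ) hη.le hη2 hc.1 hc.2 hz).trans
      (Complex.abs_re_le_norm _)
  · have hη : 0 < G.vertexWeight x * δ := mul_pos hw hδ.1
    refine WeightedGraph.vertexSpectralMeasure_le_of_ball x hc.1 (by positivity) fun hμ z hz => ?_
    obtain ⟨p, hp⟩ := hconn.exists_walk_length_eq_dist z x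
    rw [← hp, le_div_iff₀ (Real.sqrt_pos.2 hη)] at hz
    exact (p.le_abs_inner_of_sqrt (hf δ) (hadj δ) hη.le hc.2 hz).trans (Complex.abs_re_le_norm _)
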